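/- Let $m,p,q,r$ be integers with $m\neq 0$, and consider the Riccati equation $$z'=z^2+t^{-2}F(t),\qquad F(t)=\frac14\left[m^2(1-q^2)\left(\frac{t^m}{t^m-1}\right)^2-\bigl[r^2-p^2+m^2(1-q^2)\bigr]\frac{t^m}{t^m-1}+(1-p^2)\right],$$ in the complex variable $t$. Suppose that $m\nmid p$ and that, for some integer $j\in\{0,\ldots,q-1\}$ (in particular $q\geq 1$), either $p-r=(q-1-2j)m$ or $p+r=(q-1-2j)m$. Then all the solutions of the equation are meromorphic on $\mathbb{C}$ and, in fact, rational. That is, if $U\subset\{t\in\mathbb{C} : t\neq 0,\ t^m\neq 1\}$ is a nonempty connected open set and $z\colon U\to\mathbb{C}$ is a holomorphic solution of the equation, then there is a rational function $R\in\mathbb{C}(t)$, which is a meromorphic function on $\mathbb{C}$ without poles in $U$, such that $z=R$ on $U$ and such that $R$ satisfies the equation at every $t$ with $t\neq 0$ and $t^m\neq 1$ which is not a pole of $R$. -/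

import Mathlib

/-- The rational function
`F(t) = (1/4) [m²(1-q²) X² - (r² - p² + m²(1-q²)) X + (1 - p²)]` with `X = t^m / (t^m - 1)`. -/
noncomputable def riccatiF (m p q r : ℤ) (t : ℂ) : ℂ :=
  (1 / 4 : ℂ) *
    ((m : ℂ) ^ 2 * (1 - (q : ℂ) ^ 2) * (t ^ m / (t ^ m - 1)) ^ 2
      - ((r : ℂ) ^ 2 - (p : ℂ) ^ 2 + (m : ℂ) ^ 2 * (1 - (q : ℂ) ^ 2)) * (t ^ m / (t ^ m - 1))
      + (1 - (p : ℂ) ^ 2))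

/-- The complement in `ℂ` of the points where the right-hand side is given by a vanishing
denominator: the origin and the roots of `t^m = 1`. -/
def riccatiDomain (m : ℤ) : Set ℂ :=
  {t : ℂ | t ≠ 0 ∧ t ^ m ≠ 1}

/-- `z` is a (holomorphic) solution of `z' = z² + t⁻² F(t)` at every point of `U`. It is used for
open subsets `U` of `riccatiDomain m`. -/
def IsRiccatiSolutionOn (m p q r : ℤ) (z : ℂ → ℂ) (U : Set ℂ) : Prop :=
  ∀ t ∈ U, HasDerivAt z (z t ^ 2 + (t ^ 2)⁻¹ * riccatiF m p q r t) t

/-- The function on `ℂ` defined by a rational function; its value is meaningful at the points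
where the reduced denominator does not vanish. -/
noncomputable def ratFun (R : RatFunc ℂ) (t : ℂ) : ℂ :=
  R.eval (RingHom.id ℂ) t

/-- The complement in `ℂ` of the poles of a rational function. -/
def ratFunDomain (R : RatFunc ℂ) : Set ℂ :=
  {t : ℂ | R.denom.eval t ≠ 0}

/-!
Let `ℓ` be the logarithmic derivative of `t^((1-p)/2) (1-t^m)^((1-q)/2)`. Substituting
`z = -ℓ - u'/u` turns the Riccati equation into a second order linear equation for `u`; written with
`θ = t d/dt` it is `t^m ((2θ - p + (1-q)m)² - r²) u = 4 θ (θ - p) u`, a hypergeometric equation in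
`t^m` with exponents `0` and `p` at the origin. The symmetries `p ↦ -p` and `(m, p, r) ↦ (-m, r, p)`
of the Riccati equation allow `m > 0` and `p ≥ 0`. The hypothesis on `j` says that the power series
with exponent `p` terminates after `j` steps, and then the one with exponent `0` terminates after
`q - 1 - j` steps. As `m ∤ p`, neither series meets a vanishing denominator, and the two polynomials
`u`, `v` obtained are linearly independent because their exponents lie in different classes
modulo `m`.

Given a solution `z`, the functions `(z + ℓ) u + u'` and `(z + ℓ) v + v'` satisfy the same first
order linear equation `y' = (z - ℓ) y`, so a nontrivial combination of them vanishes. This is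
`(z + ℓ) w + w' = 0` for a nonzero polynomial `w`, and `z = -ℓ - w'/w` is rational.
-/

open Polynomial Filter Topology Set

section EulerOperator

variable {R : Type*} [CommRing R]

/-- The Euler operator `X d/dX` on polynomials. -/
noncomputable def eulerOp : R[X] →ₗ[R] R[X] :=
  LinearMap.mulLeft R X ∘ₗ derivative

lemma eulerOp_apply (u : R[X]) : eulerOp u = X * derivative u := rfl

lemma eulerOp_monomial (k : ℕ) (c : R) : eulerOp (monomial k c) = (k : R) • monomial k c := by
  cases k with
  | zero => simp [eulerOp_apply]
  | succ k => simp [eulerOp_apply, X_mul_monomial, smul_monomial, mul_comm]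

lemma aeval_eulerOp_monomial (A : R[X]) (k : ℕ) (c : R) :
    aeval eulerOp A (monomial k c) = monomial k (A.eval (k : R) * c) := by
  rw [Module.End.aeval_apply_of_mem_apply_eq_smul (eulerOp_monomial k c), smul_monomial,
    smul_eq_mul]

end EulerOperator

section Frobenius

variable {K : Type*} [Field K]

/-- The partial sum up to `i = n` of the Frobenius series `∑ cᵢ X^(e + i m)` with `c₀ = 1` and
`B(e + (i + 1) m) cᵢ₊₁ = A(e + i m) cᵢ` of the equation `X^m A(θ) u = B(θ) u`, where `θ` is the
Euler operator. -/
noncomputable def frobeniusPoly (A B : K[X]) (m e n : ℕ) : K[X] :=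
  ∑ i ∈ Finset.range (n + 1), monomial (e + i * m)
    (∏ l ∈ Finset.range i, A.eval ((e + l * m : ℕ) : K) / B.eval ((e + (l + 1) * m : ℕ) : K))

lemma X_pow_mul_aeval_eulerOp_frobeniusPoly {A B : K[X]} {m e n : ℕ} (hBe : B.eval (e : K) = 0)
    (hB : ∀ i < n, B.eval ((e + (i + 1) * m : ℕ) : K) ≠ 0)
    (hA : A.eval ((e + n * m : ℕ) : K) = 0) :
    X ^ m * aeval eulerOp A (frobeniusPoly A B m e n) =
      aeval eulerOp B (frobeniusPoly A B m e n) := by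
  simp only [frobeniusPoly, map_sum, aeval_eulerOp_monomial, Finset.mul_sum, X_pow_mul_monomial]
  rw [Finset.sum_range_succ, Finset.sum_range_succ', hA]
  simp only [zero_mul, add_zero, hBe, monomial_zero_right]
  refine Finset.sum_congr rfl fun i hi => ?_
  rw [Finset.prod_range_succ, mul_left_comm, mul_div_cancel₀ _ (hB i (Finset.mem_range.1 hi)),
    add_assoc, ← Nat.succ_mul, mul_comm (eval _ A)]

lemma coeff_frobeniusPoly_self (A B : K[X]) {m : ℕ} (hm : m ≠ 0) (e n : ℕ) :
    (frobeniusPoly A B m e n).coeff e = 1 := by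
  simp [frobeniusPoly, finsetSum_coeff, coeff_monomial, hm]

lemma coeff_frobeniusPoly_eq_zero (A B : K[X]) {m e k : ℕ} (hk : ¬ e ≡ k [MOD m]) (n : ℕ) :
    (frobeniusPoly A B m e n).coeff k = 0 := by
  rw [frobeniusPoly, finsetSum_coeff]
  refine Finset.sum_eq_zero fun i _ => coeff_monomial_of_ne _ ?_
  rintro rfl
  exact hk (by simp [Nat.ModEq])

lemma linearIndependent_frobeniusPoly (A B : K[X]) {m e e' : ℕ} (hm : m ≠ 0)
    (he : ¬ e ≡ e' [MOD m]) (n n' : ℕ) :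
    LinearIndependent K ![frobeniusPoly A B m e n, frobeniusPoly A B m e' n'] := by
  refine LinearIndependent.pair_iff.2 fun α β h => ⟨?_, ?_⟩
  · simpa [coeff_frobeniusPoly_self A B hm, coeff_frobeniusPoly_eq_zero A B (mt Nat.ModEq.symm he)]
      using congrArg (coeff · e) h
  · simpa [coeff_frobeniusPoly_self A B hm, coeff_frobeniusPoly_eq_zero A B he]
      using congrArg (coeff · e') h

end Frobenius

lemma hasDerivAt_riccati_linear_form {𝕜 : Type*} [NontriviallyNormedField 𝕜]
    {z ℓ u u₁ : 𝕜 → 𝕜} {g ℓ' u₂ t : 𝕜} (hz : HasDerivAt z (z t ^ 2 + g) t)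
    (hℓ : HasDerivAt ℓ ℓ' t) (hu : HasDerivAt u (u₁ t) t) (hu₁ : HasDerivAt u₁ u₂ t)
    (hode : u₂ + 2 * ℓ t * u₁ t + (ℓ' + ℓ t ^ 2 + g) * u t = 0) :
    HasDerivAt (fun s => (z s + ℓ s) * u s + u₁ s)
      ((z t - ℓ t) * ((z t + ℓ t) * u t + u₁ t)) t := by
  refine (((hz.add hℓ).mul hu).add hu₁).congr_deriv ?_
  simp only [Pi.add_apply]
  linear_combination hode

lemma exists_linear_relation_of_hasDerivAt_mul {U : Set ℂ} (hUo : IsOpen U) (hUc : IsPreconnected U)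
    {f g a : ℂ → ℂ} (hf : ∀ t ∈ U, HasDerivAt f (a t * f t) t)
    (hg : ∀ t ∈ U, HasDerivAt g (a t * g t) t) :
    ∃ α β : ℂ, (α ≠ 0 ∨ β ≠ 0) ∧ ∀ t ∈ U, α * f t + β * g t = 0 := by
  by_cases! h : ∀ t ∈ U, g t = 0
  · exact ⟨0, 1, .inr one_ne_zero, fun t ht => by simp [h t ht]⟩
  obtain ⟨t₀, ht₀, hgt₀⟩ := h
  have hnear : ∀ᶠ t in 𝓝 t₀, t ∈ U ∧ g t ≠ 0 :=
    (hUo.eventually_mem ht₀).and ((hg t₀ ht₀).continuousAt.eventually_ne hgt₀)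
  obtain ⟨ε, hε, hball⟩ := Metric.eventually_nhds_iff_ball.1 hnear
  have hquot : ∀ t ∈ Metric.ball t₀ ε, HasDerivAt (fun s => f s / g s) 0 t := by
    intro t ht
    obtain ⟨htU, hgt⟩ := hball t ht
    exact ((hf t htU).div (hg t htU) hgt).congr_deriv (by ring)
  obtain ⟨c, hc⟩ := Metric.isOpen_ball.exists_is_const_of_deriv_eq_zero
    (convex_ball t₀ ε).isPreconnected
    (fun t ht => (hquot t ht).differentiableAt.differentiableWithinAt)
    (fun t ht => (hquot t ht).deriv)
  have hdiff : DifferentiableOn ℂ (fun t => 1 * f t + -c * g t) U := fun t ht =>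
    (((hf t ht).const_mul 1).add ((hg t ht).const_mul (-c))).differentiableAt.differentiableWithinAt
  refine ⟨1, -c, .inl one_ne_zero, (hdiff.analyticOnNhd
    hUo).eqOn_zero_of_preconnected_of_eventuallyEq_zero hUc ht₀ ?_⟩
  filter_upwards [Metric.ball_mem_nhds t₀ hε] with t ht
  have hft : f t = c * g t := (div_eq_iff (hball t ht).2).1 (hc t ht)
  simp [hft]

section RationalFunctions

lemma ratFun_eq_div (R : RatFunc ℂ) (t : ℂ) : ratFun R t = R.num.eval t / R.denom.eval t := by
  simp [ratFun, RatFunc.eval, eval₂_id]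

lemma differentiableAt_ratFun {R : RatFunc ℂ} {t : ℂ} (ht : t ∈ ratFunDomain R) :
    DifferentiableAt ℂ (ratFun R) t := by
  rw [funext (ratFun_eq_div R)]
  exact R.num.differentiableAt.div R.denom.differentiableAt ht

lemma meromorphicOn_ratFun (R : RatFunc ℂ) (S : Set ℂ) : MeromorphicOn (ratFun R) S := by
  rw [funext (ratFun_eq_div R)]
  exact fun t _ => (R.num.differentiable.analyticAt t).meromorphicAt.div
    (R.denom.differentiable.analyticAt t).meromorphicAt

lemma finite_compl_ratFunDomain (R : RatFunc ℂ) : (ratFunDomain R)ᶜ.Finite :=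
  (finite_setOfPred_isRoot R.denom_ne_zero).subset fun _ ht => not_not.1 ht

lemma mem_ratFunDomain_of_mul_eq {R : RatFunc ℂ} {t c : ℂ}
    (h : c * R.denom.eval t = R.num.eval t) : t ∈ ratFunDomain R := by
  intro hden
  obtain ⟨a, b, hab⟩ := R.isCoprime_num_denom
  have hone := congrArg (Polynomial.eval t) hab
  simp [hden, ← h] at hone

lemma exists_ratFunc_eqOn {U : Set ℂ} (hUo : IsOpen U) {z : ℂ → ℂ} (hz : ContinuousOn z U)
    {A B : ℂ[X]} (hB : B ≠ 0) (h : ∀ t ∈ U, z t * B.eval t = A.eval t) :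
    ∃ R : RatFunc ℂ, U ⊆ ratFunDomain R ∧ EqOn z (ratFun R) U := by
  set R : RatFunc ℂ := algebraMap ℂ[X] (RatFunc ℂ) A / algebraMap ℂ[X] (RatFunc ℂ) B with hR
  have hcross : R.num * B = A * R.denom := (RatFunc.num_mul_eq_mul_denom_iff hB).2 hR
  have hoff : EqOn (fun t => z t * R.denom.eval t) (fun t => R.num.eval t)
      (U ∩ {t | B.IsRoot t}ᶜ) := by
    rintro t ⟨htU, htB⟩
    have hcross_t := congrArg (Polynomial.eval t) hcross
    simp only [eval_mul, ← h t htU] at hcross_t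
    exact mul_right_cancel₀ htB (by linear_combination -hcross_t)
  have hdense : Dense {t | B.IsRoot t}ᶜ := (finite_setOfPred_isRoot hB).countable.dense_compl ℂ
  have hon : EqOn (fun t => z t * R.denom.eval t) (fun t => R.num.eval t) U :=
    hoff.of_subset_closure (hz.mul R.denom.continuousOn) R.num.continuousOn inter_subset_left
      (hdense.open_subset_closure_inter hUo)
  have hsub : U ⊆ ratFunDomain R := fun t ht => mem_ratFunDomain_of_mul_eq (hon ht)
  refine ⟨R, hsub, fun t ht => ?_⟩
  rw [ratFun_eq_div, eq_div_iff (hsub ht)]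
  exact hon ht

end RationalFunctions

section RiccatiEquation

variable {m p q r : ℤ} {U V : Set ℂ} {z w : ℂ → ℂ}

lemma finite_compl_riccatiDomain (hm : m ≠ 0) : (riccatiDomain m)ᶜ.Finite := by
  have hroots := finite_setOfPred_isRoot
    (X_pow_sub_C_ne_zero (Int.natAbs_pos.2 hm) (1 : ℂ))
  refine ((finite_singleton 0).union hroots).subset fun t ht => ?_
  rcases eq_or_ne t 0 with h0 | h0
  · exact .inl h0
  have htm : t ^ m = 1 := by_contra fun h => ht ⟨h0, h⟩
  have htn : t ^ m.natAbs = 1 := by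
    rcases abs_choice m with h | h <;> rw [← zpow_natCast, Int.natCast_natAbs, h]
    · exact htm
    · rw [zpow_neg, htm, inv_one]
  exact .inr (by simp [IsRoot, htn])

lemma differentiableAt_riccatiF (m p q r : ℤ) {t : ℂ} (ht : t ∈ riccatiDomain m) :
    DifferentiableAt ℂ (riccatiF m p q r) t := by
  have hpow : DifferentiableAt ℂ (fun s : ℂ => s ^ m) t := differentiableAt_zpow.2 (.inl ht.1)
  have hquot := hpow.div (hpow.sub_const 1) (sub_ne_zero.2 ht.2)
  exact ((((hquot.pow 2).const_mul _).sub (hquot.const_mul _)).add_const _).const_mul _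

lemma riccatiDomain_neg (m : ℤ) : riccatiDomain (-m) = riccatiDomain m := by
  simp [riccatiDomain]

lemma riccatiF_neg_exponent (m p q r : ℤ) : riccatiF m (-p) q r = riccatiF m p q r := by
  funext t
  simp [riccatiF]

lemma riccatiF_neg_swap (p q r : ℤ) {t : ℂ} (ht : t ∈ riccatiDomain m) :
    riccatiF (-m) p q r t = riccatiF m r q p t := by
  have h0 : t ^ m ≠ 0 := zpow_ne_zero m ht.1
  have h1 : t ^ m - 1 ≠ 0 := sub_ne_zero.2 ht.2
  have hX : t ^ (-m) / (t ^ (-m) - 1) = 1 - t ^ m / (t ^ m - 1) := by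
    have h1' : 1 - t ^ m ≠ 0 := sub_ne_zero.2 ht.2.symm
    rw [zpow_neg]
    field_simp
    ring
  rw [riccatiF, riccatiF, hX]
  push_cast
  ring

namespace IsRiccatiSolutionOn

lemma differentiableOn (hz : IsRiccatiSolutionOn m p q r z U) : DifferentiableOn ℂ z U :=
  fun t ht => (hz t ht).differentiableAt.differentiableWithinAt

lemma congr (hz : IsRiccatiSolutionOn m p q r z U) (hUo : IsOpen U) (hzw : EqOn z w U) :
    IsRiccatiSolutionOn m p q r w U := by
  intro t ht
  rw [← hzw ht]
  exact (hz t ht).congr_of_eventuallyEq (hzw.symm.eventuallyEq_of_mem (hUo.mem_nhds ht))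

lemma extend (hz : IsRiccatiSolutionOn m p q r z U) (hUo : IsOpen U) (hUne : U.Nonempty)
    (hUV : U ⊆ V) (hVo : IsOpen V) (hVc : IsPreconnected V) (hV : V ⊆ riccatiDomain m)
    (hzV : DifferentiableOn ℂ z V) : IsRiccatiSolutionOn m p q r z V := by
  obtain ⟨t₀, ht₀⟩ := hUne
  have hrhs : DifferentiableOn ℂ (fun t => z t ^ 2 + (t ^ 2)⁻¹ * riccatiF m p q r t) V :=
    (hzV.pow 2).add (((differentiableOn_id.pow 2).inv fun t ht => pow_ne_zero 2 (hV ht).1).mul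
      fun t ht => (differentiableAt_riccatiF m p q r (hV ht)).differentiableWithinAt)
  have hderiv : EqOn (deriv z) (fun t => z t ^ 2 + (t ^ 2)⁻¹ * riccatiF m p q r t) V :=
    (hzV.analyticOnNhd hVo).deriv.eqOn_of_preconnected_of_eventuallyEq (hrhs.analyticOnNhd hVo)
      hVc (hUV ht₀) (by filter_upwards [hUo.mem_nhds ht₀] with t ht using (hz t ht).deriv)
  exact fun t ht => (hzV.differentiableAt (hVo.mem_nhds ht)).hasDerivAt.congr_deriv (hderiv ht)

lemma extend_ratFun {R : RatFunc ℂ} (hR : IsRiccatiSolutionOn m p q r (ratFun R) U)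
    (hm : m ≠ 0) (hUo : IsOpen U) (hUne : U.Nonempty) (hU : U ⊆ riccatiDomain m)
    (hUR : U ⊆ ratFunDomain R) :
    IsRiccatiSolutionOn m p q r (ratFun R) (riccatiDomain m ∩ ratFunDomain R) := by
  have hfin : (riccatiDomain m ∩ ratFunDomain R)ᶜ.Finite := by
    rw [compl_inter]
    exact (finite_compl_riccatiDomain hm).union (finite_compl_ratFunDomain R)
  have hconn : IsPreconnected (riccatiDomain m ∩ ratFunDomain R) :=
    compl_compl (riccatiDomain m ∩ ratFunDomain R) ▸
      (hfin.countable.isConnected_compl_of_one_lt_rank (by simp)).isPreconnected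
  exact hR.extend hUo hUne (subset_inter hU hUR) (isClosed_compl_iff.1 hfin.isClosed) hconn
    inter_subset_left fun t ht => (differentiableAt_ratFun ht.2).differentiableWithinAt

end IsRiccatiSolutionOn

end RiccatiEquation

section Linearization

/-- The logarithmic derivative of `t^((1-p)/2) (1-t^m)^((1-q)/2)`. -/
noncomputable def gaugeLogDeriv (m p q : ℤ) (t : ℂ) : ℂ :=
  t⁻¹ * ((1 - p) / 2 + (1 - q) / 2 * m * (t ^ m / (t ^ m - 1)))

lemma hasDerivAt_gaugeLogDeriv (m p q : ℤ) {t : ℂ} (ht : t ∈ riccatiDomain m) :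
    HasDerivAt (gaugeLogDeriv m p q)
      (-(t ^ 2)⁻¹ * ((1 - p) / 2 + (1 - q) / 2 * m * (t ^ m / (t ^ m - 1))
        + (1 - q) / 2 * m ^ 2 * (t ^ m / (t ^ m - 1) ^ 2))) t := by
  have h0 : t ≠ 0 := ht.1
  have h1 : t ^ m - 1 ≠ 0 := sub_ne_zero.2 ht.2
  have hpow := hasDerivAt_zpow m t (.inl h0)
  have hquot := ((hpow.div (hpow.sub_const 1) h1).const_mul ((1 - (q : ℂ)) / 2 * m)).const_add
    ((1 - (p : ℂ)) / 2)
  refine ((hasDerivAt_inv h0).mul hquot).congr_deriv ?_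
  rw [zpow_sub_one₀ h0]
  simp only [Pi.div_apply]
  field_simp
  ring

/-- The polynomial `(2X - p + (1-q)m)² - r²` in the Euler operator, which carries the factor `t^m`
in the linear equation attached to the Riccati equation. -/
noncomputable def stepPoly (m : ℕ) (p q r : ℤ) : ℂ[X] :=
  (C 2 * X + C ((1 - q) * m - p : ℂ)) ^ 2 - C (r ^ 2 : ℂ)

/-- The indicial polynomial at the origin of the linear equation attached to the Riccati equation,
up to a constant factor. -/
noncomputable def indicialPoly (p : ℤ) : ℂ[X] := C 4 * X * (X - C (p : ℂ))

/-- `u` is a polynomial solution of the linear equation attached to the Riccati equation, after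
division by the gauge factor `t^((1-p)/2) (1-t^m)^((1-q)/2)`. Here `m` is a natural number, so that
`t^m` is a polynomial. -/
def IsGaugedSolution (m : ℕ) (p q r : ℤ) (u : ℂ[X]) : Prop :=
  X ^ m * aeval eulerOp (stepPoly m p q r) u = aeval eulerOp (indicialPoly p) u

variable {m : ℕ} {p q r : ℤ} {u v : ℂ[X]} {t : ℂ} {U : Set ℂ} {z : ℂ → ℂ}

lemma IsGaugedSolution.eval_eq (hu : IsGaugedSolution m p q r u) (t : ℂ) :
    t ^ m * (4 * (t * u.derivative.eval t + t ^ 2 * u.derivative.derivative.eval t)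
        + 4 * ((1 - q) * m - p) * (t * u.derivative.eval t)
        + (((1 - q) * m - p) ^ 2 - r ^ 2) * u.eval t) =
      4 * (t * u.derivative.eval t + t ^ 2 * u.derivative.derivative.eval t)
        - 4 * p * (t * u.derivative.eval t) := by
  have h := congrArg (Polynomial.eval t) hu
  simp only [stepPoly, indicialPoly, map_sub, map_add, map_mul, map_one, map_intCast, map_natCast,
    map_smul, pow_two, aeval_C, aeval_X, Module.End.mul_apply, LinearMap.sub_apply,
    LinearMap.add_apply, Module.algebraMap_end_apply, Module.End.natCast_apply,
    Module.End.intCast_apply, Module.End.one_apply, nsmul_eq_mul, zsmul_eq_mul, eulerOp_apply,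
    derivative_mul, derivative_X, derivative_natCast, derivative_intCast, zero_mul, zero_add,
    one_mul, smul_add, eval_add, eval_sub, eval_mul, eval_pow, eval_smul, eval_X, eval_natCast,
    eval_intCast, smul_eq_mul] at h
  linear_combination h

lemma IsGaugedSolution.eval_ode (hu : IsGaugedSolution m p q r u) (ht : t ∈ riccatiDomain m) :
    u.derivative.derivative.eval t + 2 * gaugeLogDeriv m p q t * u.derivative.eval t
      + (deriv (gaugeLogDeriv m p q) t + gaugeLogDeriv m p q t ^ 2
        + (t ^ 2)⁻¹ * riccatiF m p q r t) * u.eval t = 0 := by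
  have h0 : t ≠ 0 := ht.1
  have h1 : t ^ m - 1 ≠ 0 := by simpa using sub_ne_zero.2 ht.2
  rw [(hasDerivAt_gaugeLogDeriv m p q ht).deriv]
  simp only [gaugeLogDeriv, riccatiF, zpow_natCast, Int.cast_natCast]
  field_simp
  linear_combination 4 * (t ^ m - 1) * hu.eval_eq t

lemma IsGaugedSolution.hasDerivAt_linear_form (hu : IsGaugedSolution m p q r u)
    (ht : t ∈ riccatiDomain m)
    (hz : HasDerivAt z (z t ^ 2 + (t ^ 2)⁻¹ * riccatiF m p q r t) t) :
    HasDerivAt (fun s => (z s + gaugeLogDeriv m p q s) * u.eval s + u.derivative.eval s)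
      ((z t - gaugeLogDeriv m p q t)
        * ((z t + gaugeLogDeriv m p q t) * u.eval t + u.derivative.eval t)) t :=
  hasDerivAt_riccati_linear_form hz (hasDerivAt_gaugeLogDeriv m p q ht).differentiableAt.hasDerivAt
    (u.hasDerivAt t) (u.derivative.hasDerivAt t) (hu.eval_ode ht)

lemma IsRiccatiSolutionOn.exists_logDeriv_relation (hz : IsRiccatiSolutionOn m p q r z U)
    (hUo : IsOpen U) (hUc : IsPreconnected U) (hU : U ⊆ riccatiDomain m)
    (hu : IsGaugedSolution m p q r u) (hv : IsGaugedSolution m p q r v)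
    (huv : LinearIndependent ℂ ![u, v]) :
    ∃ w : ℂ[X], w ≠ 0 ∧
      ∀ t ∈ U, (z t + gaugeLogDeriv m p q t) * w.eval t + w.derivative.eval t = 0 := by
  obtain ⟨α, β, hαβ, hrel⟩ := exists_linear_relation_of_hasDerivAt_mul hUo hUc
    (fun t ht => hu.hasDerivAt_linear_form (hU ht) (hz t ht))
    (fun t ht => hv.hasDerivAt_linear_form (hU ht) (hz t ht))
  refine ⟨α • u + β • v, fun h0 => ?_, fun t ht => ?_⟩
  · obtain ⟨hα, hβ⟩ := LinearIndependent.pair_iff.1 huv α β h0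
    exact hαβ.elim (· hα) (· hβ)
  · simp only [derivative_add, derivative_smul, eval_add, eval_smul, smul_eq_mul]
    linear_combination hrel t ht

lemma exists_polynomial_mul_eq_of_logDeriv_relation {w : ℂ[X]} (hm : m ≠ 0) (hw : w ≠ 0)
    (hU : U ⊆ riccatiDomain m)
    (h : ∀ t ∈ U, (z t + gaugeLogDeriv m p q t) * w.eval t + w.derivative.eval t = 0) :
    ∃ A B : ℂ[X], B ≠ 0 ∧ ∀ t ∈ U, z t * B.eval t = A.eval t := by
  refine ⟨-((C ((1 - p) / 2 : ℂ) * (X ^ m - C 1) + C ((1 - q) / 2 * m : ℂ) * X ^ m) * w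
      + X * (X ^ m - C 1) * derivative w), X * (X ^ m - C 1) * w,
    mul_ne_zero (mul_ne_zero X_ne_zero (X_pow_sub_C_ne_zero (Nat.pos_of_ne_zero hm) 1)) hw,
    fun t ht => ?_⟩
  have h0 : t ≠ 0 := (hU ht).1
  have h1 : t ^ m - 1 ≠ 0 := by simpa using sub_ne_zero.2 (hU ht).2
  have ht' := h t ht
  simp only [gaugeLogDeriv, zpow_natCast, Int.cast_natCast] at ht'
  simp only [eval_neg, eval_add, eval_sub, eval_mul, eval_pow, eval_C, eval_X]
  field_simp at ht' ⊢
  linear_combination ht'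

end Linearization

section Termination

/-- The arithmetic condition under which both Frobenius series of the linear equation, with
exponents `0` and `p`, terminate. -/
def IsTerminating (m p q r : ℤ) : Prop :=
  ∃ j : ℤ, 0 ≤ j ∧ j ≤ q - 1 ∧
    (p - r = (q - 1 - 2 * j) * m ∨ p + r = (q - 1 - 2 * j) * m)

variable {m p q r : ℤ}

lemma IsTerminating.neg_exponent (h : IsTerminating m p q r) : IsTerminating m (-p) q r := by
  obtain ⟨j, hj₀, hj₁, hj⟩ := h
  exact ⟨q - 1 - j, by lia, by lia, hj.symm.imp (fun h => by linear_combination -h)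
    (fun h => by linear_combination -h)⟩

lemma IsTerminating.neg_swap (h : IsTerminating m p q r) : IsTerminating (-m) r q p := by
  obtain ⟨j, hj₀, hj₁, hj | hj⟩ := h
  · exact ⟨j, hj₀, hj₁, .inl (by linear_combination -hj)⟩
  · exact ⟨q - 1 - j, by lia, by lia, .inr (by linear_combination hj)⟩

lemma IsTerminating.dvd (h : IsTerminating m p q r) (hr : m ∣ r) : m ∣ p := by
  obtain ⟨j, -, -, hj | hj⟩ := h
  · exact (dvd_sub_left hr).1 (hj ▸ dvd_mul_left m _)
  · exact (dvd_add_left hr).1 (hj ▸ dvd_mul_left m _)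

lemma isGaugedSolution_frobeniusPoly {m p e n : ℕ} (hm : m ≠ 0) (he : e = 0 ∨ e = p)
    (hep : ∀ i, e + (i + 1) * m ≠ p)
    (hn : (2 * (e + n * m) + ((1 - q) * m - p)) ^ 2 = r ^ 2) :
    IsGaugedSolution m p q r (frobeniusPoly (stepPoly m p q r) (indicialPoly p) m e n) := by
  refine X_pow_mul_aeval_eulerOp_frobeniusPoly ?_ (fun i _ => ?_) ?_
  · rcases he with rfl | rfl <;> simp [indicialPoly]
  · have hpos : ((e + (i + 1) * m : ℕ) : ℂ) ≠ 0 := by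
      exact_mod_cast (Nat.add_pos_right e (by positivity)).ne'
    have hne : ((e + (i + 1) * m : ℕ) : ℂ) ≠ (p : ℤ) := by exact_mod_cast hep i
    simpa only [indicialPoly, eval_mul, eval_sub, eval_C, eval_X] using
      mul_ne_zero (mul_ne_zero (by norm_num : (4 : ℂ) ≠ 0) hpos) (sub_ne_zero.2 hne)
  · have hnℂ : (2 * (e + n * m) + ((1 - q) * m - p) : ℂ) ^ 2 = r ^ 2 := by exact_mod_cast hn
    simp [stepPoly, hnℂ]

lemma exists_linearIndependent_isGaugedSolution {m p : ℕ} (hm : m ≠ 0) (hp : ¬ m ∣ p)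
    (h : IsTerminating m p q r) :
    ∃ u v : ℂ[X], LinearIndependent ℂ ![u, v] ∧
      IsGaugedSolution m p q r u ∧ IsGaugedSolution m p q r v := by
  obtain ⟨j, hj₀, hjq, hj⟩ := h
  lift j to ℕ using hj₀ with n
  obtain ⟨n', hn'⟩ := Int.eq_ofNat_of_zero_le (sub_nonneg.2 hjq)
  have hind : ¬ p ≡ 0 [MOD m] := fun h0 => hp (Nat.modEq_zero_iff_dvd.1 h0)
  refine ⟨_, _, linearIndependent_frobeniusPoly _ _ hm hind n n',
    isGaugedSolution_frobeniusPoly hm (.inr rfl) (fun i => ?_) ?_,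
    isGaugedSolution_frobeniusPoly hm (.inl rfl) (fun i hi => ?_) ?_⟩
  · have := Nat.mul_pos i.succ_pos (Nat.pos_of_ne_zero hm)
    lia
  · rw [sq_eq_sq_iff_eq_or_eq_neg]
    exact hj.imp (fun h => by linear_combination h) (fun h => by linear_combination h)
  · exact hp ⟨i + 1, by linear_combination -hi⟩
  · rw [sq_eq_sq_iff_eq_or_eq_neg, ← hn']
    exact hj.symm.imp (fun h => by push_cast; linear_combination -h)
      (fun h => by push_cast; linear_combination -h)

end Termination

namespace IsRiccatiSolutionOn

variable {m p q r : ℤ} {U : Set ℂ} {z : ℂ → ℂ}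

lemma exists_polynomial_mul_eq_of_natCast {m p : ℕ} (hz : IsRiccatiSolutionOn m p q r z U)
    (hUo : IsOpen U) (hUc : IsPreconnected U) (hU : U ⊆ riccatiDomain m) (hm : m ≠ 0)
    (hp : ¬ m ∣ p) (h : IsTerminating m p q r) :
    ∃ A B : ℂ[X], B ≠ 0 ∧ ∀ t ∈ U, z t * B.eval t = A.eval t := by
  obtain ⟨u, v, huv, hu, hv⟩ := exists_linearIndependent_isGaugedSolution hm hp h
  obtain ⟨w, hw, hrel⟩ := hz.exists_logDeriv_relation hUo hUc hU hu hv huv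
  exact exists_polynomial_mul_eq_of_logDeriv_relation hm hw hU hrel

lemma exists_polynomial_mul_eq_of_natCast_left {m : ℕ} (hz : IsRiccatiSolutionOn m p q r z U)
    (hUo : IsOpen U) (hUc : IsPreconnected U) (hU : U ⊆ riccatiDomain m) (hm : m ≠ 0)
    (hp : ¬ (m : ℤ) ∣ p) (h : IsTerminating m p q r) :
    ∃ A B : ℂ[X], B ≠ 0 ∧ ∀ t ∈ U, z t * B.eval t = A.eval t := by
  obtain ⟨k, rfl | rfl⟩ := p.eq_nat_or_neg
  · exact hz.exists_polynomial_mul_eq_of_natCast hUo hUc hU hm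
      (mt Int.natCast_dvd_natCast.2 hp) h
  · rw [dvd_neg, Int.natCast_dvd_natCast] at hp
    have hz' : IsRiccatiSolutionOn m k q r z U := fun t ht =>
      riccatiF_neg_exponent m k q r ▸ hz t ht
    exact hz'.exists_polynomial_mul_eq_of_natCast hUo hUc hU hm hp
      (neg_neg (k : ℤ) ▸ h.neg_exponent)

theorem exists_polynomial_mul_eq (hz : IsRiccatiSolutionOn m p q r z U) (hUo : IsOpen U)
    (hUc : IsPreconnected U) (hU : U ⊆ riccatiDomain m) (hm : m ≠ 0) (hp : ¬ m ∣ p)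
    (h : IsTerminating m p q r) :
    ∃ A B : ℂ[X], B ≠ 0 ∧ ∀ t ∈ U, z t * B.eval t = A.eval t := by
  obtain ⟨n, rfl | rfl⟩ := m.eq_nat_or_neg
  · exact hz.exists_polynomial_mul_eq_of_natCast_left hUo hUc hU (by simpa using hm) hp h
  · rw [riccatiDomain_neg] at hU
    have hz' : IsRiccatiSolutionOn n r q p z U := fun t ht =>
      riccatiF_neg_swap p q r (hU ht) ▸ hz t ht
    have hr : ¬ (n : ℤ) ∣ r := fun hr => hp (h.dvd (neg_dvd.2 hr))
    exact hz'.exists_polynomial_mul_eq_of_natCast_left hUo hUc hU (by simpa using hm) hr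
      (neg_neg (n : ℤ) ▸ h.neg_swap)

end IsRiccatiSolutionOn

theorem mainTheorem4 (m p q r : ℤ) (hm : m ≠ 0) (hp : ¬ m ∣ p)
    (hj : ∃ j : ℤ, 0 ≤ j ∧ j ≤ q - 1 ∧
      (p - r = (q - 1 - 2 * j) * m ∨ p + r = (q - 1 - 2 * j) * m))
    (U : Set ℂ) (hUo : IsOpen U) (hUc : IsConnected U) (hU : U ⊆ riccatiDomain m)
    (z : ℂ → ℂ) (hz : IsRiccatiSolutionOn m p q r z U) :
    ∃ R : RatFunc ℂ,
      MeromorphicOn (ratFun R) Set.univ ∧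
      IsRiccatiSolutionOn m p q r (ratFun R) (riccatiDomain m ∩ ratFunDomain R) ∧
      U ⊆ ratFunDomain R ∧
      Set.EqOn z (ratFun R) U := by
  obtain ⟨A, B, hB, hAB⟩ := hz.exists_polynomial_mul_eq hUo hUc.isPreconnected hU hm hp hj
  obtain ⟨R, hUR, hzR⟩ := exists_ratFunc_eqOn hUo hz.differentiableOn.continuousOn hB hAB
  have hR : IsRiccatiSolutionOn m p q r (ratFun R) U := hz.congr hUo hzR
  exact ⟨R, meromorphicOn_ratFun R univ, hR.extend_ratFun hm hUo hUc.nonempty hU hUR, hUR, hzR⟩
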